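/- For each number of agents $n\ge 1$ let $m=m(n)$ be a number of goods, and write $m=xn+y$ with integers $x=x(n)\ge 0$ and $0\le y<n$. For each $n$ and each good $j\in\{1,\dots,m\}$ let $\mathcal U_j=\mathcal U_j^{(n)}$ be a probability distribution on $[0,1]$ that is $(\alpha_j,\beta_j)$-PDF-bounded, i.e. has a density $f_j$ with $0<\alpha_j\le f_j(t)\le\beta_j$ for all $t\in[0,1]$; the numbers $\alpha_j=\alpha_j^{(n)}$, $\beta_j=\beta_j^{(n)}$ may differ from good to good. Put $\alpha_{\min}(n)=\min_j\alpha_j^{(n)}$ and assume $\log n/(\alpha_{\min}(n)\,n)\to 0$ as $n\to\infty$ (in particular, this holds if $\alpha_{\min}(n)$ is bounded below by a positive constant). Agent $i\in\{1,\dots,n\}$ has utility $u_i(j)\sim\mathcal U_j$ for good $j$, where all $u_i(j)$ are independent, and utilities are additive: $u_i(S)=\sum_{j\in S}u_i(j)$. An allocation $(A_1,\dots,A_n)$ is a partition of all goods $M=\{1,\dots,m\}$ into $n$ (possibly empty) bundles; it is proportional if $u_i(A_i)\ge u_i(M)/n$ for every agent $i$. Let $c<1$ be a constant such that every $\mathcal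 U_j^{(n)}$ has mean at most $c$. If $$x(n)\ \ge\ r:=\left\lceil \frac{2(3+c)}{1-c}\right\rceil\qquad\text{for all } n\ge 1,$$ then the probability that a proportional allocation exists tends to $1$ as $n\to\infty$. -/

import Mathlib

open MeasureTheory ProbabilityTheory Filter Topology

namespace FairDivision

/-- A measure `μ` on `ℝ` is `(α, β)`-PDF-bounded: it is supported on `[0, 1]` and has a density `f`
with respect to Lebesgue measure with `α ≤ f x ≤ β` for all `x ∈ [0, 1]`. Such a measure has no
atoms. -/
def IsPDFBounded (α β : ℝ) (μ : Measure ℝ) : Prop :=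
  ∃ f : ℝ → ℝ, Measurable f ∧ (∀ x ∈ Set.Icc (0 : ℝ) 1, α ≤ f x ∧ f x ≤ β) ∧
    μ = (volume.restrict (Set.Icc (0 : ℝ) 1)).withDensity (fun x => ENNReal.ofReal (f x))

/-- An allocation of the goods `Fin m` to the agents `Fin n`: every good goes to exactly one
agent. -/
abbrev Allocation (n m : ℕ) : Type := Fin m → Fin n

/-- The bundle `A_i` of agent `i` under the allocation `A`. -/
def Allocation.bundle {n m : ℕ} (A : Allocation n m) (i : Fin n) : Finset (Fin m) :=
  Finset.univ.filter (fun j => A j = i)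

/-- The additive extension of the utilities `v` of the single goods to sets of goods. -/
def bundleUtility {m : ℕ} (v : Fin m → ℝ) (S : Finset (Fin m)) : ℝ :=
  ∑ j ∈ S, v j

/-- The allocation `A` is proportional for the utilities `u`: every agent `i` values its own bundle
at no less than a `1 / n` fraction of its value for the set of all goods. -/
def IsProportional {n m : ℕ} (u : Fin n → Fin m → ℝ) (A : Allocation n m) : Prop :=
  ∀ i : Fin n, bundleUtility (u i) Finset.univ / (n : ℝ) ≤ bundleUtility (u i) (A.bundle i)

end FairDivision

namespace FairDivision

/-! Split the first `x * n` goods into `x` blocks of `n`, and join an agent to a good of a block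
when the value is at least `1 - δ`. An edge is missing with probability at most `exp (-(a * δ))`,
`a` being the least density bound, so Hall's theorem and a union bound give each block a perfect
matching except with probability `1 / n` (`measure_not_exists_matching_le`). As `x` may grow
arbitrarily with `n`, asking all blocks to succeed is too much. Markov's inequality
(`measure_lt_card_le`) shows that at most `δ * x` blocks fail, except with probability `1 / (n *
δ)`. Each agent then gets at least `(1 - δ) ^ 2 * x`, while by Hoeffding its proportional share is
at most `(c + δ) * (x + 1)`. The lower bound on `x` makes the former larger for `δ = (1 - c) / 8`.
-/

theorem IsPDFBounded.ae_mem_Icc {α β : ℝ} {μ : Measure ℝ} (h : IsPDFBounded α β μ) :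
    ∀ᵐ t ∂μ, t ∈ Set.Icc (0 : ℝ) 1 := by
  obtain ⟨f, -, -, rfl⟩ := h
  exact (withDensity_absolutelyContinuous _ _).ae_le (ae_restrict_mem measurableSet_Icc)

theorem IsPDFBounded.le_measure_Icc {α β : ℝ} {μ : Measure ℝ} (h : IsPDFBounded α β μ)
    {δ : ℝ} (hδ : δ ≤ 1) :
    ENNReal.ofReal α * ENNReal.ofReal δ ≤ μ (Set.Icc (1 - δ) 1) := by
  obtain ⟨f, hf, hfb, rfl⟩ := h
  have hsub : Set.Icc (1 - δ) 1 ⊆ Set.Icc (0 : ℝ) 1 :=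
    Set.Icc_subset_Icc_left (by linarith)
  rw [withDensity_apply _ measurableSet_Icc, Measure.restrict_restrict measurableSet_Icc,
    Set.inter_eq_self_of_subset_left hsub]
  calc ENNReal.ofReal α * ENNReal.ofReal δ
      = ∫⁻ _ in Set.Icc (1 - δ) 1, ENNReal.ofReal α := by
        rw [setLIntegral_const, Real.volume_Icc]; congr 2; ring
    _ ≤ _ := setLIntegral_mono' measurableSet_Icc fun t ht =>
        ENNReal.ofReal_le_ofReal (hfb t (hsub ht)).1

/-- The top interval of length `δ` has mass at least `α * δ`, and `1 - z ≤ exp (-z)`. The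
exponential form multiplies well over independent edges. -/
theorem IsPDFBounded.measureReal_Iio_le {α β : ℝ} {μ : Measure ℝ} [IsProbabilityMeasure μ]
    (h : IsPDFBounded α β μ) (hα : 0 ≤ α) {δ : ℝ} (hδ0 : 0 ≤ δ) (hδ : δ ≤ 1) :
    μ.real (Set.Iio (1 - δ)) ≤ Real.exp (-(α * δ)) := by
  have h1 : α * δ ≤ μ.real (Set.Icc (1 - δ) 1) := by
    have := ENNReal.toReal_mono (measure_ne_top _ _) (h.le_measure_Icc hδ)
    rwa [ENNReal.toReal_mul, ENNReal.toReal_ofReal hα, ENNReal.toReal_ofReal hδ0] at this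
  have h2 : μ.real (Set.Icc (1 - δ) 1) ≤ μ.real (Set.Iio (1 - δ))ᶜ :=
    measureReal_mono fun t ht => by simpa using ht.1
  rw [probReal_compl_eq_one_sub measurableSet_Iio] at h2
  linarith [Real.one_sub_le_exp_neg (α * δ)]

/-! ### Perfect matchings in random bipartite graphs -/

/-- Since `n - t = s - 1`, both binomials are at most `n ^ s`. Since `t ≥ n / 2`, the exponential is
at most `n ^ (-4 * s)`. -/
theorem choose_mul_choose_mul_exp_le_aux {n s t : ℕ} (hs : 1 ≤ s) (hst : s ≤ t)
    (hn : s + t = n + 1) {p : ℝ} (hp : 0 ≤ p) (hlog : 8 * Real.log n ≤ p * n) :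
    (n.choose s : ℝ) * n.choose t * Real.exp (-(p * (s * t))) ≤ 1 / (n : ℝ) ^ 2 := by
  have hn1 : 1 ≤ n := by omega
  have hn1' : (1 : ℝ) ≤ n := by exact_mod_cast hn1
  have hn0 : (0 : ℝ) < n := by linarith
  have h1 : (n.choose s : ℝ) ≤ (n : ℝ) ^ s := by exact_mod_cast Nat.choose_le_pow n s
  have h2 : (n.choose t : ℝ) ≤ (n : ℝ) ^ s := by
    have : n.choose t = n.choose (s - 1) := by
      rw [← Nat.choose_symm (show t ≤ n by omega)]; congr 1; omega
    rw [this]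
    exact_mod_cast (Nat.choose_le_pow n (s - 1)).trans (Nat.pow_le_pow_right hn1 (by omega))
  have h3 : Real.exp (-(p * (s * t))) ≤ 1 / (n : ℝ) ^ (4 * s) := by
    rw [Real.exp_neg, ← one_div]
    refine one_div_le_one_div_of_le (by positivity) ?_
    rw [← Real.exp_log (pow_pos hn0 (4 * s)), Real.log_pow]
    refine Real.exp_le_exp.2 ?_
    have ht : (n : ℝ) ≤ 2 * t := by exact_mod_cast (by omega : n ≤ 2 * t)
    have h5 : 4 * Real.log n ≤ p * t := by nlinarith
    have h6 := mul_le_mul_of_nonneg_left h5 (Nat.cast_nonneg (α := ℝ) s)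
    push_cast
    linarith
  calc (n.choose s : ℝ) * n.choose t * Real.exp (-(p * (s * t)))
      ≤ (n : ℝ) ^ s * (n : ℝ) ^ s * (1 / (n : ℝ) ^ (4 * s)) := by gcongr
    _ = 1 / (n : ℝ) ^ (2 * s) := by field_simp; ring
    _ ≤ 1 / (n : ℝ) ^ 2 :=
        one_div_le_one_div_of_le (by positivity) (pow_le_pow_right₀ hn1' (by omega))

theorem choose_mul_choose_mul_exp_le {n s t : ℕ} (hs : 1 ≤ s) (ht : 1 ≤ t)
    (hn : s + t = n + 1) {p : ℝ} (hp : 0 ≤ p) (hlog : 8 * Real.log n ≤ p * n) :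
    (n.choose s : ℝ) * n.choose t * Real.exp (-(p * (s * t))) ≤ 1 / (n : ℝ) ^ 2 := by
  rcases le_total s t with h | h
  · exact choose_mul_choose_mul_exp_le_aux hs h hn hp hlog
  · rw [mul_comm (n.choose s : ℝ), mul_comm (s : ℝ)]
    exact choose_mul_choose_mul_exp_le_aux ht h (by omega) hp hlog

/-- If a bipartite graph on `n + n` vertices has no perfect matching, then by Hall's theorem there
are sets of vertices on the two sides, of total size `n + 1`, with no edge between them. -/
theorem exists_finset_of_not_exists_injective {n : ℕ} (r : Fin n → Fin n → Prop)
    (h : ¬ ∃ f : Fin n → Fin n, Function.Injective f ∧ ∀ i, r i (f i)) :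
    ∃ s ∈ Finset.Icc 1 n, ∃ S ∈ Finset.univ.powersetCard s,
      ∃ T ∈ Finset.univ.powersetCard (n + 1 - s), ∀ i ∈ S, ∀ j ∈ T, ¬ r i j := by
  classical
  rw [← Fintype.all_card_le_filter_rel_iff_exists_injective] at h
  push Not at h
  obtain ⟨S, hS⟩ := h
  obtain ⟨W, hW, hWS⟩ : ∃ W : Finset (Fin n), (∀ b, b ∈ W ↔ ∃ a ∈ S, r a b) ∧ W.card < S.card :=
    ⟨_, by simp, hS⟩
  have hSn : S.card ≤ n := by simpa using S.card_le_univ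
  have hc := W.card_compl_add_card
  rw [Fintype.card_fin] at hc
  -- `W` is the neighbourhood of the Hall violator `S`; its complement is trimmed so that the two
  -- sizes add up to exactly `n + 1`.
  obtain ⟨T, hT, hTc⟩ := Finset.exists_subset_card_eq (show n + 1 - S.card ≤ Wᶜ.card by omega)
  refine ⟨S.card, Finset.mem_Icc.2 ⟨by omega, hSn⟩, S, by simp, T, by simp [hTc], ?_⟩
  intro i hi j hj hr
  exact Finset.mem_compl.1 (hT hj) ((hW j).2 ⟨i, hi, hr⟩)

section Probability

variable {Ω : Type*} [MeasurableSpace Ω] {P : Measure Ω}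

theorem measure_forall_lt_le {n : ℕ} {X : Fin n → Fin n → Ω → ℝ}
    (hX : iIndepFun (fun p : Fin n × Fin n => X p.1 p.2) P) {θ p : ℝ}
    (hp : ∀ i j, P {ω | X i j ω < θ} ≤ ENNReal.ofReal (Real.exp (-p))) (S T : Finset (Fin n)) :
    P {ω | ∀ i ∈ S, ∀ j ∈ T, X i j ω < θ} ≤
      ENNReal.ofReal (Real.exp (-(p * (S.card * T.card)))) := by
  have h := hX.measure_inter_preimage_eq_mul (S ×ˢ T) (sets := fun _ => Set.Iio θ)
    fun _ _ => measurableSet_Iio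
  have hset : {ω | ∀ i ∈ S, ∀ j ∈ T, X i j ω < θ} =
      ⋂ q ∈ S ×ˢ T, (fun p : Fin n × Fin n => X p.1 p.2) q ⁻¹' Set.Iio θ := by
    ext ω
    simp only [Set.mem_ofPred_eq, Set.mem_iInter, Finset.mem_product, Set.mem_preimage,
      Set.mem_Iio, Prod.forall]
    exact ⟨fun H i j hij => H i hij.1 j hij.2, fun H i hi j hj => H i j ⟨hi, hj⟩⟩
  rw [hset, h]
  calc _ ≤ ∏ _q ∈ S ×ˢ T, ENNReal.ofReal (Real.exp (-p)) :=
        Finset.prod_le_prod' fun q _ => hp q.1 q.2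
    _ = _ := by
        rw [Finset.prod_const, ← ENNReal.ofReal_pow (Real.exp_pos _).le, ← Real.exp_nat_mul,
          Finset.card_product]
        congr 2
        push_cast
        ring

/-- A random bipartite graph on `n + n` vertices with independent edges, each present with
probability at least `1 - exp (-p)` where `p ≥ 8 log n / n`, has a perfect matching with probability
at least `1 - 1 / n`. -/
theorem measure_not_exists_matching_le {n : ℕ} (hn : 1 ≤ n) {X : Fin n → Fin n → Ω → ℝ}
    (hX : iIndepFun (fun p : Fin n × Fin n => X p.1 p.2) P) {θ p : ℝ} (hp0 : 0 ≤ p)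
    (hp : ∀ i j, P {ω | X i j ω < θ} ≤ ENNReal.ofReal (Real.exp (-p)))
    (hlog : 8 * Real.log n ≤ p * n) :
    P {ω | ¬ ∃ f : Fin n → Fin n, Function.Injective f ∧ ∀ i, θ ≤ X i (f i) ω} ≤
      ENNReal.ofReal (1 / n) := by
  have hn0 : (0 : ℝ) < n := by exact_mod_cast hn
  have hsub : {ω | ¬ ∃ f : Fin n → Fin n, Function.Injective f ∧ ∀ i, θ ≤ X i (f i) ω} ⊆
      ⋃ s ∈ Finset.Icc 1 n, ⋃ S ∈ Finset.univ.powersetCard s,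
        ⋃ T ∈ Finset.univ.powersetCard (n + 1 - s), {ω | ∀ i ∈ S, ∀ j ∈ T, X i j ω < θ} := by
    intro ω hω
    obtain ⟨s, hs, S, hS, T, hT, H⟩ :=
      exists_finset_of_not_exists_injective (fun i j => θ ≤ X i j ω) hω
    simp only [Set.mem_iUnion]
    exact ⟨s, hs, S, hS, T, hT, fun i hi j hj => not_le.1 (H i hi j hj)⟩
  calc _ ≤ ∑ s ∈ Finset.Icc 1 n, ∑ S ∈ Finset.univ.powersetCard s,
        ∑ T ∈ Finset.univ.powersetCard (n + 1 - s),
          P {ω | ∀ i ∈ S, ∀ j ∈ T, X i j ω < θ} := by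
        refine (measure_mono hsub).trans ((measure_biUnion_finset_le _ _).trans ?_)
        refine Finset.sum_le_sum fun s _ => (measure_biUnion_finset_le _ _).trans ?_
        exact Finset.sum_le_sum fun S _ => measure_biUnion_finset_le _ _
    _ ≤ ∑ s ∈ Finset.Icc 1 n, ENNReal.ofReal (1 / (n : ℝ) ^ 2) := by
        refine Finset.sum_le_sum fun s hs => ?_
        rw [Finset.mem_Icc] at hs
        calc _ ≤ ∑ S ∈ (Finset.univ : Finset (Fin n)).powersetCard s,
              ∑ T ∈ (Finset.univ : Finset (Fin n)).powersetCard (n + 1 - s),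
              ENNReal.ofReal (Real.exp (-(p * (s * (n + 1 - s : ℕ))))) := by
              refine Finset.sum_le_sum fun S hS => Finset.sum_le_sum fun T hT => ?_
              have := measure_forall_lt_le hX hp S T
              rwa [(Finset.mem_powersetCard.1 hS).2, (Finset.mem_powersetCard.1 hT).2] at this
          _ = ENNReal.ofReal ((n.choose s : ℝ) * n.choose (n + 1 - s) *
                Real.exp (-(p * (s * (n + 1 - s : ℕ))))) := by
              rw [Finset.sum_const, Finset.sum_const, Finset.card_powersetCard,
                Finset.card_powersetCard, Finset.card_univ, Fintype.card_fin, nsmul_eq_mul,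
                nsmul_eq_mul, ENNReal.ofReal_mul (by positivity),
                ENNReal.ofReal_mul (by positivity), ENNReal.ofReal_natCast,
                ENNReal.ofReal_natCast, mul_assoc]
          _ ≤ _ := ENNReal.ofReal_le_ofReal
              (choose_mul_choose_mul_exp_le hs.1 (by omega) (by omega) hp0 hlog)
    _ = ENNReal.ofReal (1 / n) := by
        rw [Finset.sum_const, Nat.card_Icc, nsmul_eq_mul, Nat.add_sub_cancel,
          ← ENNReal.ofReal_natCast, ← ENNReal.ofReal_mul hn0.le]
        congr 1
        field_simp

/-! ### Markov and Hoeffding bounds -/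

theorem measure_lt_card_le {k : ℕ} (hk : 0 < k) (R : Fin k → Set Ω) {q : ENNReal}
    (hR : ∀ t, P (R t) ≤ q) {δ : ℝ} (hδ : 0 < δ) :
    P {ω | δ * k < Nat.card {t // ω ∈ R t}} ≤ q / ENNReal.ofReal δ := by
  classical
  -- The events need not be measurable, so Markov's inequality is applied to their measurable hulls.
  set R' : Fin k → Set Ω := fun t => toMeasurable P (R t) with hR'
  have hk0 : (0 : ℝ) < k := by exact_mod_cast hk
  have hint : ∫⁻ ω, ∑ t, (R' t).indicator 1 ω ∂P ≤ k * q := by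
    rw [lintegral_finsetSum' _ fun t _ =>
      (measurable_one.indicator (measurableSet_toMeasurable P (R t))).aemeasurable]
    calc _ ≤ ∑ _t : Fin k, q := Finset.sum_le_sum fun t _ => by
          rw [lintegral_indicator_one (measurableSet_toMeasurable P (R t)), measure_toMeasurable]
          exact hR t
      _ = _ := by simp
  have hk' : ENNReal.ofReal (δ * k) = ENNReal.ofReal δ * k := by
    rw [ENNReal.ofReal_mul hδ.le, ENNReal.ofReal_natCast]
  calc _ ≤ P {ω | ENNReal.ofReal (δ * k) ≤ ∑ t, (R' t).indicator 1 ω} := by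
        refine measure_mono fun ω hω => ?_
        have hω : δ * k < Nat.card {t // ω ∈ R t} := hω
        have h1 : ((Nat.card {t // ω ∈ R t} : ℕ) : ENNReal) ≤ ∑ t, (R' t).indicator 1 ω := by
          rw [Nat.card_eq_fintype_card, Fintype.card_subtype, ← Finset.sum_boole]
          refine Finset.sum_le_sum fun t _ => ?_
          split_ifs with h
          · rw [Set.indicator_of_mem (subset_toMeasurable P (R t) h)]; rfl
          · exact zero_le
        refine le_trans ?_ h1
        rw [← ENNReal.ofReal_natCast]
        exact ENNReal.ofReal_le_ofReal hω.le
    _ ≤ (∫⁻ ω, ∑ t, (R' t).indicator 1 ω ∂P) / ENNReal.ofReal (δ * k) := by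
        refine meas_ge_le_lintegral_div ?_ ?_ ENNReal.ofReal_ne_top
        · exact Finset.aemeasurable_fun_sum _ fun t _ =>
            (measurable_one.indicator (measurableSet_toMeasurable P (R t))).aemeasurable
        · exact (ENNReal.ofReal_pos.2 (by positivity)).ne'
    _ ≤ (k * q) / ENNReal.ofReal (δ * k) := by gcongr
    _ = q / ENNReal.ofReal δ := by
        rw [hk', mul_comm (k : ENNReal)]
        exact ENNReal.mul_div_mul_right _ _ (by simpa using hk.ne') (ENNReal.natCast_ne_top k)

theorem measure_add_mul_le_sum_le [IsProbabilityMeasure P] {m : ℕ} (hm : 0 < m) {X : Fin m → Ω → ℝ} (hX : iIndepFun X P)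
    (hmeas : ∀ j, AEMeasurable (X j) P) (hI : ∀ j, ∀ᵐ ω ∂P, X j ω ∈ Set.Icc (0 : ℝ) 1) {c δ : ℝ}
    (hc : ∀ j, ∫ ω, X j ω ∂P ≤ c) (hδ : 0 ≤ δ) :
    P {ω | (c + δ) * m ≤ ∑ j, X j ω} ≤ ENNReal.ofReal (Real.exp (-(2 * δ ^ 2 * m))) := by
  have hm0 : (0 : ℝ) < m := by exact_mod_cast hm
  have hind : iIndepFun (fun j ω => X j ω - ∫ ω, X j ω ∂P) P :=
    hX.comp (fun j z => z - ∫ ω, X j ω ∂P) fun j => measurable_id.sub_const _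
  have h := HasSubgaussianMGF.measure_sum_ge_le_of_iIndepFun hind (s := Finset.univ)
    (fun j _ => hasSubgaussianMGF_of_mem_Icc (hmeas j) (hI j))
    (show 0 ≤ δ * m by positivity)
  have hsub : {ω | (c + δ) * m ≤ ∑ j, X j ω} ⊆
      {ω | δ * m ≤ ∑ j, (X j ω - ∫ ω, X j ω ∂P)} := by
    intro ω hω
    have hω : (c + δ) * m ≤ ∑ j, X j ω := hω
    have h2 : ∑ j, ∫ ω, X j ω ∂P ≤ m * c := by
      simpa using Finset.sum_le_sum fun j (_ : j ∈ Finset.univ) => hc j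
    simp only [Set.mem_ofPred_eq, Finset.sum_sub_distrib]
    linarith
  refine (measure_mono hsub).trans ?_
  rw [← ofReal_measureReal]
  refine ENNReal.ofReal_le_ofReal (h.trans (le_of_eq ?_))
  congr 1
  simp
  field_simp

end Probability

/-! ### From matchings to proportional allocations -/

/-- If sufficiently many of `k` disjoint blocks of `n` goods admit a perfect matching in which every
agent gets a good of value at least `θ`, then some allocation gives each agent the sum of these
values. -/
theorem exists_allocation_of_matchings {n m k : ℕ} (hn : 0 < n) {u : Fin n → Fin m → ℝ}
    (hu : ∀ i j, 0 ≤ u i j) {g : Fin k × Fin n → Fin m} (hg : Function.Injective g)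
    (G : Finset (Fin k)) {θ : ℝ}
    (hG : ∀ t ∈ G, ∃ f : Fin n → Fin n, Function.Injective f ∧ ∀ i, θ ≤ u i (g (t, f i))) :
    ∃ A : Allocation n m, ∀ i, G.card * θ ≤ bundleUtility (u i) (A.bundle i) := by
  classical
  choose f hf hfθ using hG
  let e : G × Fin n → Fin m := fun p => g (p.1, f p.1 p.1.2 p.2)
  have he : Function.Injective e := by
    rintro ⟨⟨t, ht⟩, i⟩ ⟨⟨t', ht'⟩, i'⟩ h
    have h := Prod.ext_iff.1 (hg h)
    obtain rfl : t = t' := h.1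
    obtain rfl : i = i' := hf t ht h.2
    rfl
  -- Goods outside the matchings all go to agent `0`; values being nonnegative, this harms nobody.
  refine ⟨Function.extend e Prod.snd fun _ => ⟨0, hn⟩, fun i => ?_⟩
  have hinj : Function.Injective fun t : G => e (t, i) := fun t t' h => (Prod.ext_iff.1 (he h)).1
  calc (G.card : ℝ) * θ = ∑ _t : G, θ := by simp
    _ ≤ ∑ t : G, u i (e (t, i)) := Finset.sum_le_sum fun t _ => hfθ t t.2 i
    _ = ∑ j ∈ Finset.univ.map ⟨_, hinj⟩, u i j := by simp
    _ ≤ _ := by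
        refine Finset.sum_le_sum_of_subset_of_nonneg (fun j hj => ?_) fun j _ _ => hu i j
        obtain ⟨t, -, rfl⟩ := Finset.mem_map.1 hj
        simp only [Allocation.bundle, Finset.mem_filter, Finset.mem_univ, true_and,
          Function.Embedding.coeFn_mk]
        exact he.extend_apply _ _ (t, i)

/-- The first `k * n` of `m` goods, split into `k` blocks of `n` goods. -/
def blockGood {k n m : ℕ} (h : k * n ≤ m) (p : Fin k × Fin n) : Fin m :=
  Fin.castLE h (finProdFinEquiv p)

theorem blockGood_injective {k n m : ℕ} (h : k * n ≤ m) : Function.Injective (blockGood h) :=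
  (Fin.castLE_injective h).comp finProdFinEquiv.injective

/-- Failure to match all agents to distinct goods of value at least `θ` within block `t`. -/
def IsUnmatchedBlock {n m k : ℕ} (h : k * n ≤ m) (u : Fin n → Fin m → ℝ) (θ : ℝ) (t : Fin k) :
    Prop :=
  ¬ ∃ f : Fin n → Fin n, Function.Injective f ∧ ∀ i, θ ≤ u i (blockGood h (t, f i))

theorem exists_isProportional {n m k : ℕ} (hn : 0 < n) (h : k * n ≤ m) (hm : m < (k + 1) * n)
    {u : Fin n → Fin m → ℝ} (hu : ∀ i j, 0 ≤ u i j) {c δ : ℝ} (hδ1 : δ ≤ 1) (hcδ : 0 ≤ c + δ)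
    (hkey : (c + δ) * (k + 1) ≤ (1 - δ) * (1 - δ) * k)
    (hsum : ∀ i, ∑ j, u i j ≤ (c + δ) * m)
    (hbad : (Nat.card {t // IsUnmatchedBlock h u (1 - δ) t} : ℝ) ≤ δ * k) :
    ∃ A : Allocation n m, IsProportional u A := by
  classical
  have hn0 : (0 : ℝ) < n := by exact_mod_cast hn
  obtain ⟨A, hA⟩ := exists_allocation_of_matchings hn hu (blockGood_injective h)
    (Finset.univ.filter fun t => ¬ IsUnmatchedBlock h u (1 - δ) t) (θ := 1 - δ)
    fun t ht => not_not.1 (Finset.mem_filter.1 ht).2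
  refine ⟨A, fun i => le_trans ?_ (hA i)⟩
  have hcard : (1 - δ) * k ≤
      ((Finset.univ.filter fun t => ¬ IsUnmatchedBlock h u (1 - δ) t).card : ℝ) := by
    have := Finset.card_filter_add_card_filter_not (s := (Finset.univ : Finset (Fin k)))
      (IsUnmatchedBlock h u (1 - δ))
    rw [Finset.card_univ, Fintype.card_fin] at this
    rw [Nat.card_eq_fintype_card, Fintype.card_subtype] at hbad
    have h' := congrArg (Nat.cast (R := ℝ)) this
    push_cast at h'
    linarith
  have hm' : (m : ℝ) ≤ (k + 1) * n := by exact_mod_cast hm.le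
  calc bundleUtility (u i) Finset.univ / n ≤ (c + δ) * m / n :=
        div_le_div_of_nonneg_right (hsum i) hn0.le
    _ ≤ (c + δ) * ((k + 1) * n) / n := by gcongr
    _ = (c + δ) * (k + 1) := by field_simp
    _ ≤ (1 - δ) * (1 - δ) * k := hkey
    _ = (1 - δ) * k * (1 - δ) := by ring
    _ ≤ _ := mul_le_mul_of_nonneg_right hcard (by linarith)

/-- The first error term is Hoeffding's bound summed over the agents, weakened by `n ≤ m`; the
second is Markov's bound on the failed blocks. -/
theorem measure_not_exists_isProportional_le {Ω : Type*} [MeasurableSpace Ω] {P : Measure Ω}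
    [IsProbabilityMeasure P] {n m k : ℕ} (hn : 0 < n) (hk : 0 < k) (h : k * n ≤ m)
    (hm : m < (k + 1) * n) {α β : Fin m → ℝ} {U : Fin m → Measure ℝ}
    [∀ j, IsProbabilityMeasure (U j)] (hU : ∀ j, IsPDFBounded (α j) (β j) (U j))
    {u : Fin n → Fin m → Ω → ℝ} (hlaw : ∀ i j, HasLaw (u i j) (U j) P)
    (hind : iIndepFun (fun p : Fin n × Fin m => u p.1 p.2) P) {a c δ : ℝ} (ha : 0 ≤ a)
    (haα : ∀ j, a ≤ α j) (hmean : ∀ j, ∫ t, t ∂(U j) ≤ c) (hδ0 : 0 < δ) (hδ1 : δ ≤ 1)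
    (hcδ : 0 ≤ c + δ) (hkey : (c + δ) * (k + 1) ≤ (1 - δ) * (1 - δ) * k)
    (hlog : 8 * Real.log n ≤ a * δ * n) :
    P {ω | ¬ ∃ A : Allocation n m, IsProportional (fun i j => u i j ω) A} ≤
      ENNReal.ofReal (n * Real.exp (-(2 * δ ^ 2 * n)) + 1 / n / δ) := by
  have hn0 : (0 : ℝ) < n := by exact_mod_cast hn
  have hnm : n ≤ m := le_trans (Nat.le_mul_of_pos_left n hk) h
  have hI : ∀ i j, ∀ᵐ ω ∂P, u i j ω ∈ Set.Icc (0 : ℝ) 1 := fun i j =>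
    ((hlaw i j).ae_iff (p := fun t => t ∈ Set.Icc (0 : ℝ) 1)
      (measurableSet_setOfPred.1 measurableSet_Icc)).2 (hU j).ae_mem_Icc
  have hI' : ∀ᵐ ω ∂P, ∀ i j, u i j ω ∈ Set.Icc (0 : ℝ) 1 :=
    ae_all_iff.2 fun i => ae_all_iff.2 fun j => hI i j
  have hsum : ∀ i, P {ω | (c + δ) * m ≤ ∑ j, u i j ω} ≤
      ENNReal.ofReal (Real.exp (-(2 * δ ^ 2 * n))) := by
    intro i
    refine (measure_add_mul_le_sum_le (by omega)
      (hind.precomp (g := fun j => (i, j)) (Prod.mk_right_injective i))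
      (fun j => (hlaw i j).aemeasurable) (hI i) (fun j => ?_) hδ0.le).trans ?_
    · exact (hlaw i j).integral_eq.trans_le (hmean j)
    · have : (n : ℝ) ≤ m := by exact_mod_cast hnm
      gcongr
  have hblock : ∀ t, P {ω | IsUnmatchedBlock h (fun i j => u i j ω) (1 - δ) t} ≤
      ENNReal.ofReal (1 / n) := by
    intro t
    refine measure_not_exists_matching_le hn (X := fun i j => u i (blockGood h (t, j)))
      (hind.precomp (g := fun p : Fin n × Fin n => (p.1, blockGood h (t, p.2))) ?_)
      (p := a * δ) (by positivity) (fun i j => ?_) hlog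
    · rintro ⟨i, j⟩ ⟨i', j'⟩ hij
      have hij := Prod.ext_iff.1 hij
      exact Prod.ext hij.1 (Prod.ext_iff.1 (blockGood_injective h hij.2)).2
    · rw [(hlaw i _).measure_eq (p := fun t => t < 1 - δ) measurableSet_Iio, ← ofReal_measureReal]
      refine ENNReal.ofReal_le_ofReal
        (((hU _).measureReal_Iio_le (ha.trans (haα _)) hδ0.le hδ1).trans ?_)
      gcongr
      exact haα _
  have hcount := measure_lt_card_le hk _ hblock hδ0
  calc _ ≤ P ((⋃ i, {ω | (c + δ) * m ≤ ∑ j, u i j ω}) ∪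
        {ω | δ * k < Nat.card {t // IsUnmatchedBlock h (fun i j => u i j ω) (1 - δ) t}}) := by
        refine measure_mono_ae ?_
        filter_upwards [hI'] with ω hω hbad
        by_contra hgood
        change ω ∉ (_ ∪ _ : Set Ω) at hgood
        simp only [Set.mem_union, Set.mem_iUnion, not_or, not_exists] at hgood
        exact hbad (exists_isProportional hn h hm (fun i j => (hω i j).1) hδ1 hcδ hkey
          (fun i => (not_le.1 (hgood.1 i)).le) (not_lt.1 hgood.2))
    _ ≤ ∑ _i : Fin n, ENNReal.ofReal (Real.exp (-(2 * δ ^ 2 * n))) +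
          ENNReal.ofReal (1 / n) / ENNReal.ofReal δ := by
        refine (measure_union_le _ _).trans (add_le_add ?_ hcount)
        exact (measure_iUnion_fintype_le _ _).trans (Finset.sum_le_sum fun i _ => hsum i)
    _ = _ := by
        rw [ENNReal.ofReal_add (by positivity) (by positivity), ENNReal.ofReal_mul hn0.le,
          ENNReal.ofReal_div_of_pos hδ0]
        simp

theorem tendsto_failure_bound {δ : ℝ} (hδ : 0 < δ) :
    Tendsto (fun n : ℕ => ENNReal.ofReal (n * Real.exp (-(2 * δ ^ 2 * n)) + 1 / n / δ))
      atTop (𝓝 0) := by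
  have h1 : Tendsto (fun x : ℝ => x * Real.exp (-(2 * δ ^ 2 * x))) atTop (𝓝 0) := by
    simpa using tendsto_rpow_mul_exp_neg_mul_atTop_nhds_zero 1 (2 * δ ^ 2) (by positivity)
  have h2 := h1.comp (tendsto_natCast_atTop_atTop (R := ℝ))
  simpa [Function.comp_def] using ENNReal.tendsto_ofReal
    (h2.add ((tendsto_one_div_atTop_nhds_zero_nat (𝕜 := ℝ)).div_const δ))

end FairDivision

theorem mainTheorem3
    (c : ℝ) (hc : c < 1)
    (m x y : ℕ → ℕ)
    (hm : ∀ n : ℕ, 0 < n → m n = x n * n + y n ∧ y n < n)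
    (hx : ∀ n : ℕ, 0 < n → ⌈2 * (3 + c) / (1 - c)⌉ ≤ (x n : ℤ))
    (α β : (n : ℕ) → Fin (m n) → ℝ)
    (hα : ∀ (n : ℕ) (j : Fin (m n)), 0 < α n j)
    (hα_min : Tendsto (fun n : ℕ => Real.log n / ((⨅ j : Fin (m n), α n j) * n)) atTop (𝓝 0))
    (U : (n : ℕ) → Fin (m n) → Measure ℝ)
    (hU_prob : ∀ (n : ℕ) (j : Fin (m n)), IsProbabilityMeasure (U n j))
    (hU_pdf : ∀ (n : ℕ) (j : Fin (m n)), FairDivision.IsPDFBounded (α n j) (β n j) (U n j))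
    (hU_mean : ∀ (n : ℕ) (j : Fin (m n)), ∫ t, t ∂(U n j) ≤ c)
    (Ω : ℕ → Type*) [∀ n : ℕ, MeasurableSpace (Ω n)]
    (P : (n : ℕ) → Measure (Ω n)) [∀ n : ℕ, IsProbabilityMeasure (P n)]
    (u : (n : ℕ) → Fin n → Fin (m n) → Ω n → ℝ)
    (hu_law : ∀ (n : ℕ) (i : Fin n) (j : Fin (m n)), HasLaw (u n i j) (U n j) (P n))
    (hu_indep : ∀ n : ℕ, iIndepFun (fun p : Fin n × Fin (m n) => u n p.1 p.2) (P n)) :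
    Tendsto
      (fun n : ℕ => P n {ω | ∃ A : FairDivision.Allocation n (m n),
        FairDivision.IsProportional (fun i j => u n i j ω) A})
      atTop (𝓝 1) := by
  have hgoods : ∀ n, 0 < m n → 0 ≤ c := by
    intro n hn
    refine le_trans (integral_nonneg_of_ae ?_) (hU_mean n ⟨0, hn⟩)
    filter_upwards [(hU_pdf n ⟨0, hn⟩).ae_mem_Icc] with t ht using ht.1
  -- Means are nonnegative, so `c < 0` leaves no goods for positive `n`, and every allocation is
  -- proportional.
  rcases lt_or_ge c 0 with hc0 | hc0
  · refine tendsto_const_nhds.congr' ?_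
    filter_upwards [eventually_gt_atTop 0] with n hn
    have hmn : m n = 0 := by
      by_contra h
      linarith [hgoods n (Nat.pos_of_ne_zero h)]
    have : IsEmpty (Fin (m n)) := by rw [hmn]; infer_instance
    rw [← measure_univ (μ := P n)]
    congr 1
    refine (Set.eq_univ_of_forall fun ω => ?_).symm
    exact ⟨fun j => isEmptyElim j, fun i => by
      simp [FairDivision.bundleUtility, Finset.eq_empty_of_isEmpty]⟩
  set δ : ℝ := (1 - c) / 8 with hδ
  have hδ0 : 0 < δ := by rw [hδ]; linarith
  have hδ1 : δ ≤ 1 := by rw [hδ]; linarith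
  have hx' : ∀ n, 0 < n → 6 + 2 * c ≤ (1 - c) * x n := by
    intro n hn
    have h1 := Int.ceil_le.1 (hx n hn)
    rw [div_le_iff₀ (by linarith)] at h1
    push_cast at h1
    linarith
  refine tendsto_of_tendsto_of_tendsto_of_le_of_le'
    (g := fun n : ℕ => 1 - ENNReal.ofReal (n * Real.exp (-(2 * δ ^ 2 * n)) + 1 / n / δ))
    ?_ tendsto_const_nhds ?_ (Eventually.of_forall fun n => prob_le_one)
  · simpa using ENNReal.Tendsto.sub tendsto_const_nhds
      (FairDivision.tendsto_failure_bound hδ0) (Or.inl ENNReal.one_ne_top)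
  filter_upwards [eventually_gt_atTop 0, hα_min.eventually_le_const (show 0 < δ / 8 by positivity)]
    with n hn hlog
  obtain ⟨hmn, hyn⟩ := hm n hn
  have hxn := hx' n hn
  have hxpos : 0 < x n := by
    rcases Nat.eq_zero_or_pos (x n) with h | h
    · rw [h] at hxn
      norm_num at hxn
      linarith
    · exact h
  have hmle : x n * n ≤ m n := by omega
  have hmpos : 0 < m n := lt_of_lt_of_le (Nat.mul_pos hxpos hn) hmle
  have : Nonempty (Fin (m n)) := ⟨⟨0, hmpos⟩⟩
  have ha : 0 < ⨅ j : Fin (m n), α n j := by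
    obtain ⟨j, hj⟩ := exists_eq_ciInf_of_finite (f := α n)
    rw [← hj]
    exact hα n j
  have hn0 : (0 : ℝ) < n := by exact_mod_cast hn
  rw [div_le_iff₀ (by positivity)] at hlog
  have := hU_prob n
  have hfail := FairDivision.measure_not_exists_isProportional_le hn hxpos hmle
    (by rw [hmn, add_mul, one_mul]; omega) (hU_pdf n) (hu_law n) (hu_indep n) ha.le
    (fun j => ciInf_le (Set.finite_range _).bddBelow j) (hU_mean n) hδ0 hδ1 (by linarith)
    (by rw [hδ]; nlinarith) (by linarith)
  refine (tsub_le_tsub_left hfail 1).trans ?_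
  -- Subadditivity suffices here, so measurability of the event is not needed.
  rw [tsub_le_iff_right, ← measure_univ (μ := P n)]
  refine (measure_mono fun ω _ => ?_).trans (measure_union_le _ _)
  exact em _
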